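/- Let $n\ge 2$, $q_{12},q_{21}>0$ and $\lambda\ge 0$, and put $\pi_1=\frac{q_{21}}{q_{12}+q_{21}}$, $\pi_2=\frac{q_{12}}{q_{12}+q_{21}}$. For $\lambda_s>0$ consider the following gossip network of $n$ nodes. The source state $Q(t)\in\{1,2\}$ is a continuous-time Markov chain that moves from $1$ to $2$ at rate $q_{12}$ and from $2$ to $1$ at rate $q_{21}$ (so $\pi$ is its stationary distribution). Node $j$ stores a packet with content $S_j(t)\in\{1,2\}$ and version age $X_j(t)\in\{0,1,2,\dots\}$. Each change of the source state increases every version age by $1$. The source sends its state to each node $j$ at rate $\lambda_s/n$; then $S_j$ becomes $Q$ and $X_j$ becomes $0$. For each ordered pair $i\ne j$, node $i$ sends its packet to node $j$ at rate $\lambda/(n-1)$; if $X_i<X_j$, then $(S_j,X_j)$ becomes $(S_i,X_i)$, and otherwise nothing changes. All these Poisson clocks are independent. The initial state is any deterministic state in which nodes with equal version age have equal content and nodes with version age $0$ have content $Q(0)$. For a nonempty set $A$ of nodes let $C_A(t)=\frac1{|A|}\sum_{\ell\in A}\mathbf 1_{\{S_\ell(t)=Q(t)\}}$ be its average accuracy,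 and let $F_A(t)=\mathbf 1_{\{S_{\ell^*}(t)=Q(t)\}}$ with $\ell^*\in\arg\min_{\ell\in A}X_\ell(t)$ be the accuracy of its freshest node. Then for every $\lambda_s>0$ and $m\in\{1,2\}$ the limits $$f_2^{(m)}=\lim_{t\to\infty}\mathbb E\bigl[F_A(t)\mathbf 1_{\{Q(t)=m\}}\bigr]\quad(|A|=2),\qquad c^{(m)}=\lim_{t\to\infty}\mathbb E\bigl[C_A(t)\mathbf 1_{\{Q(t)=m\}}\bigr]\quad(A\ne\emptyset)$$ exist and depend neither on $A$ nor on the initial state; $\lim_{t\to\infty}\mathbb E[C_A(t)]=c:=c^{(1)}+c^{(2)}$ for every nonempty $A$; and, with $\mu=\lambda_s/n$, the vector $(c^{(1)},c^{(2)})^T$ is the unique solution of $$\begin{bmatrix} q_{12}+\mu+\lambda & q_{21}\\ q_{12} & q_{21}+\mu+\lambda\end{bmatrix}\mathbf c=\begin{bmatrix} q_{21}\pi_2+\mu\pi_1\\ q_{12}\pi_1+\mu\pi_2\end{bmatrix}+\lambda\begin{bmatrix} f_2^{(1)}\\ f_2^{(2)}\end{bmatrix}.$$ Moreover, with $n,q_{12},q_{21},\lambda$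 fixed, $$\lim_{\lambda_s\to\infty}c^{(m)}=\pi_m\quad(m\in\{1,2\}),\qquad\text{and hence}\qquad \lim_{\lambda_s\to\infty}c=\pi_1+\pi_2=1.$$ -/

import Mathlib

open Filter Topology MeasureTheory ProbabilityTheory
open scoped Matrix

namespace GossipAccuracy

noncomputable section

/-- The rates of the model: source transition rates `q12` (from state 1 to state 2) and `q21`
(from state 2 to state 1), total source push rate `lamS`, and gossip rate `lam` of each node. -/
structure Rates where
  q12 : ℝ
  q21 : ℝ
  lamS : ℝ
  lam : ℝ

/-- State of the network: the state of the binary source (`0` and `1` stand for the states 1 and 2),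
the content of the packet stored at each node, and the version age of that packet. -/
structure NetState (n : ℕ) where
  source : Fin 2
  content : Fin n → Fin 2
  age : Fin n → ℕ

/-- Equal versions carry equal contents, and a packet of the current version carries the current
source state. -/
def NetState.Consistent {n : ℕ} (z : NetState n) : Prop :=
  (∀ i j, z.age i = z.age j → z.content i = z.content j) ∧
    ∀ i, z.age i = 0 → z.content i = z.source

/-- The transitions: `flip m` is the source leaving state `m`; `push j` is the source updating node
`j`; `gossip p` is node `p.1.1` sending its packet to node `p.1.2`. -/
inductive Event (n : ℕ) : Type
  | flip (m : Fin 2) : Event n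
  | push (j : Fin n) : Event n
  | gossip (p : {p : Fin n × Fin n // p.1 ≠ p.2}) : Event n

/-- Every set of transitions is measurable. -/
instance (n : ℕ) : MeasurableSpace (Event n) := ⊤

/-- The transitions as a disjoint union. -/
def eventEquiv (n : ℕ) :
    (Fin 2 ⊕ Fin n ⊕ {p : Fin n × Fin n // p.1 ≠ p.2}) ≃ Event n where
  toFun x := match x with
    | .inl m => .flip m
    | .inr (.inl j) => .push j
    | .inr (.inr p) => .gossip p
  invFun e := match e with
    | .flip m => .inl m
    | .push j => .inr (.inl j)
    | .gossip p => .inr (.inr p)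
  left_inv x := by rcases x with m | j | p <;> rfl
  right_inv e := by cases e <;> rfl

instance (n : ℕ) : Fintype (Event n) := Fintype.ofEquiv _ (eventEquiv n)

/-- The rate at which the clock of each transition rings. -/
def Rates.rate (r : Rates) (n : ℕ) : Event n → ℝ
  | .flip m => if m = 0 then r.q12 else r.q21
  | .push _ => r.lamS / n
  | .gossip _ => r.lam / ((n : ℝ) - 1)

/-- Effect of a ring of the clock of a transition. The clock of `flip m` acts only while the source
is in state `m`; then the source moves to the other state and all version ages grow by one. A pushed
packet is always accepted; a gossiped packet is accepted if and only if it is strictly fresher than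
the stored one. -/
def step {n : ℕ} (e : Event n) (z : NetState n) : NetState n :=
  match e with
  | .flip m =>
      if z.source = m then
        { source := 1 - m, content := z.content, age := fun l => z.age l + 1 }
      else z
  | .push j =>
      { source := z.source
        content := Function.update z.content j z.source
        age := Function.update z.age j 0 }
  | .gossip p =>
      if z.age p.1.1 < z.age p.1.2 then
        { source := z.source
          content := Function.update z.content p.1.2 (z.content p.1.1)
          age := Function.update z.age p.1.2 (z.age p.1.1) }
      else z

/-- Total rate of all the clocks. -/
def Rates.total (r : Rates) (n : ℕ) : ℝ := ∑ e : Event n, r.rate n e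

/-- Law of the type of a ring: type `e` has probability `rate e / total`. -/
def markMeasure (r : Rates) (n : ℕ) : Measure (Event n) :=
  ∑ e : Event n, ENNReal.ofReal (r.rate n e / r.total n) • Measure.dirac e

/-- A realization of the clocks: the successive waiting times between rings, and the successive
types of the rings. -/
abbrev ClockSpace (n : ℕ) : Type := (ℕ → ℝ) × (ℕ → Event n)

/-- Law of the superposition of independent Poisson clocks, one for each transition `e`, with rate
`rate e`: independent exponential waiting times with the total rate, and independent types. -/
def clockMeasure (r : Rates) (n : ℕ) : Measure (ClockSpace n) :=
  (Measure.infinitePi fun _ : ℕ => expMeasure (r.total n)).prod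
    (Measure.infinitePi fun _ : ℕ => markMeasure r n)

/-- Number of rings up to time `t`. -/
def ringCount {n : ℕ} (ω : ClockSpace n) (t : ℝ) : ℕ :=
  Set.ncard {k : ℕ | ∑ i ∈ Finset.range (k + 1), ω.1 i ≤ t}

/-- State after `k` rings, started from `z₀`. -/
def stateAfter {n : ℕ} (z₀ : NetState n) (ω : ClockSpace n) : ℕ → NetState n
  | 0 => z₀
  | k + 1 => step (ω.2 k) (stateAfter z₀ ω k)

/-- State of the network at time `t`, started from `z₀`. -/
def stateAt {n : ℕ} (z₀ : NetState n) (ω : ClockSpace n) (t : ℝ) : NetState n :=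
  stateAfter z₀ ω (ringCount ω t)

/-- Expectation of a function of the state of the network at time `t`. -/
def expect {n : ℕ} (r : Rates) (z₀ : NetState n) (ψ : NetState n → ℝ) (t : ℝ) : ℝ :=
  ∫ ω, ψ (stateAt z₀ ω t) ∂(clockMeasure r n)

/-- Accuracy of one node: whether its content is the current state of the source. -/
def nodeAccuracy {n : ℕ} (z : NetState n) (l : Fin n) : ℝ :=
  if z.content l = z.source then 1 else 0

/-- Average accuracy of the set `A` of nodes. -/
def avgAccuracy {n : ℕ} (A : Finset (Fin n)) (z : NetState n) : ℝ :=
  (∑ l ∈ A, nodeAccuracy z l) / (A.card : ℝ)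

open Classical in
/-- Accuracy of the freshest node of `A`. In a consistent state all freshest nodes of `A` hold the
same content. -/
def freshAccuracy {n : ℕ} (A : Finset (Fin n)) (z : NetState n) : ℝ :=
  if ∃ j ∈ A, (∀ l ∈ A, z.age j ≤ z.age l) ∧ z.content j = z.source then 1 else 0

/-- Indicator that the source is in state `m`. -/
def modeIndicator {n : ℕ} (m : Fin 2) (z : NetState n) : ℝ :=
  if z.source = m then 1 else 0

/-- The generator matrix of the source. -/
def Rates.generator (r : Rates) : Matrix (Fin 2) (Fin 2) ℝ :=
  !![-r.q12, r.q12; r.q21, -r.q21]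

/-- The stationary distribution of a source with transition rates `q12` and `q21`. -/
def stationary (q12 q21 : ℝ) : Fin 2 → ℝ :=
  ![q21 / (q12 + q21), q12 / (q12 + q21)]

/-- `stationary` gives the only stationary distribution of the source. -/
theorem stationary_iff (r : Rates) (h12 : 0 < r.q12) (h21 : 0 < r.q21) (p : Fin 2 → ℝ) :
    (p ᵥ* r.generator = 0 ∧ ∑ m, p m = 1) ↔ p = stationary r.q12 r.q21 := by
  have hs : r.q12 + r.q21 ≠ 0 := by positivity
  constructor
  · rintro ⟨h, h1⟩
    have h0 := congrFun h 0
    simp [Rates.generator, Matrix.vecMul, dotProduct, Fin.sum_univ_two] at h0 h1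
    ext m
    fin_cases m
    · simp only [stationary, Fin.zero_eta, Matrix.cons_val_zero]
      rw [eq_div_iff hs]
      linear_combination r.q21 * h1 - h0
    · simp only [stationary, Fin.mk_one, Matrix.cons_val_one, Matrix.cons_val_fin_one]
      rw [eq_div_iff hs]
      linear_combination r.q12 * h1 + h0
  · rintro rfl
    constructor
    · ext m
      fin_cases m <;>
        simp [Rates.generator, stationary, Matrix.vecMul, dotProduct, Fin.sum_univ_two] <;>
        field_simp <;> ring
    · simp [stationary, Fin.sum_univ_two]
      field_simp
      ring

/-- Coefficient matrix of the linear system of the mode-tagged average accuracies, with per-node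
push rate `lamS / n`. -/
def Rates.systemMatrix (r : Rates) (n : ℕ) : Matrix (Fin 2) (Fin 2) ℝ :=
  !![r.q12 + r.lamS / n + r.lam, r.q21;
     r.q12, r.q21 + r.lamS / n + r.lam]

/-- Constant vector of the linear system of the mode-tagged average accuracies. -/
def Rates.systemVector (r : Rates) (n : ℕ) : Fin 2 → ℝ :=
  ![r.q21 * stationary r.q12 r.q21 1 + r.lamS / n * stationary r.q12 r.q21 0,
    r.q12 * stationary r.q12 r.q21 0 + r.lamS / n * stationary r.q12 r.q21 1]

end

end GossipAccuracy

open GossipAccuracy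

/-! The clocks ring at a constant total rate whatever the state, rings without effect included. So
the state at time `t` is a discrete chain driven by i.i.d. marks, stopped at a ring count that is
independent of the marks and tends to infinity almost surely. By Fubini and dominated convergence
(`tendsto_expect`), any limit along the chain is a limit in continuous time.

Along the chain, one step changes an expectation by the expected `drift` divided by the total rate.
For the freshest-node accuracy of `A`, a source flip turns it into its complement, a push into `A`
sets it to 1, and a gossip from `i` into `A` replaces it by the accuracy of `insert i A`. Hence the
two mode-tagged accuracies of `A` satisfy a planar affine recursion, forced only by the mode
probabilities and by the accuracies of sets with one more node (`drift_freshAccuracy`). The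
recursion contracts in the ℓ¹ norm, so it converges when its forcing does
(`tendsto_planar_recursion`). Descending induction on the size, starting from all `n` nodes, gives
limits that depend only on the size of `A`.

Size 1, forced by size 2, is the linear system of the theorem, since an average accuracy is a mean
over singletons. Its determinant is positive, which gives uniqueness. All other quantities in the
system being bounded, the push rate times `c - π` stays bounded as the push rate grows, so `c` tends
to `π`. -/

namespace GossipAccuracy

/-! ### Waiting times and the ring count -/

/-- Partial sums of independent copies of an almost surely positive random variable diverge. -/
theorem ae_tendsto_sum_infinitePi_atTop {μ : Measure ℝ} [IsProbabilityMeasure μ]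
    (hμ : ∀ᵐ x ∂μ, 0 < x) :
    ∀ᵐ τ ∂(Measure.infinitePi fun _ : ℕ => μ),
      Tendsto (fun k => ∑ i ∈ Finset.range k, τ i) atTop atTop := by
  set P := Measure.infinitePi fun _ : ℕ => μ
  -- Truncation to [0, 1] makes the strong law applicable without a moment assumption; on positive
  -- values it only lowers the sums.
  let f : ℝ → ℝ := fun x => min (max x 0) 1
  have hf : Measurable f := by fun_prop
  have hf0 : ∀ x, 0 ≤ f x := fun x => le_min (le_max_right _ _) zero_le_one
  have hf1 : ∀ x, f x ≤ 1 := fun x => min_le_right _ _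
  have hev : ∀ i : ℕ, MeasurePreserving (fun τ : ℕ → ℝ => τ i) P μ :=
    fun i => measurePreserving_eval_infinitePi _ i
  have hfi : Integrable f μ := Integrable.of_bound hf.aestronglyMeasurable 1
    (Eventually.of_forall fun x => by rw [Real.norm_of_nonneg (hf0 x)]; exact hf1 x)
  have hind : iIndepFun (fun (i : ℕ) (τ : ℕ → ℝ) => f (τ i)) P :=
    iIndepFun_infinitePi (X := fun _ => f) fun _ => hf
  have hslln := strong_law_ae_real (μ := P) (fun (i : ℕ) (τ : ℕ → ℝ) => f (τ i))
    ((hev 0).integrable_comp_of_integrable hfi) (fun i j hij => hind.indepFun hij)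
    (fun i => by
      have h : ∀ j : ℕ, IdentDistrib (fun τ : ℕ → ℝ => τ j) id P μ := fun j =>
        ⟨(hev j).measurable.aemeasurable, aemeasurable_id, by rw [(hev j).map_eq, Measure.map_id]⟩
      exact ((h i).trans (h 0).symm).comp hf)
  have hpos : 0 < ∫ τ, f (τ 0) ∂P := by
    rw [← integral_map (φ := fun τ : ℕ → ℝ => τ 0) (hev 0).measurable.aemeasurable
      hf.aestronglyMeasurable, (hev 0).map_eq, integral_pos_iff_support_of_nonneg hf0 hfi]
    have : ∀ᵐ x ∂μ, x ∈ Function.support f := hμ.mono fun x hx => by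
      simp only [Function.mem_support, f]
      exact (lt_min (lt_max_of_lt_left hx) one_pos).ne'
    have hm : MeasurableSet (Function.support f) := hf (measurableSet_singleton 0).compl
    rw [(mem_ae_iff_prob_eq_one hm).1 this]
    exact one_pos
  have hall : ∀ᵐ τ ∂P, ∀ i : ℕ, 0 < τ i :=
    ae_all_iff.2 fun i => (hev i).quasiMeasurePreserving.ae hμ
  filter_upwards [hslln, hall] with τ hτ h0
  have h1 : Tendsto (fun k : ℕ => (∑ i ∈ Finset.range k, f (τ i)) / k * k) atTop atTop :=
    hτ.pos_mul_atTop hpos tendsto_natCast_atTop_atTop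
  refine tendsto_atTop_mono' _ ?_ h1
  filter_upwards [eventually_gt_atTop 0] with k hk
  rw [div_mul_cancel₀ _ (by positivity)]
  exact Finset.sum_le_sum fun i _ => (min_le_left _ _).trans (max_le le_rfl (h0 i).le)

theorem ae_pos_expMeasure {c : ℝ} (hc : 0 < c) : ∀ᵐ x ∂(expMeasure c), 0 < x := by
  have := isProbabilityMeasure_expMeasure hc
  have h := cdf_expMeasure_eq hc 0
  simp only [le_refl, if_true, mul_zero, neg_zero, Real.exp_zero, sub_self, cdf_eq_real] at h
  rw [measureReal_eq_zero_iff] at h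
  rw [ae_iff]
  convert h using 2
  ext x
  simp

variable {n : ℕ}

instance : DiscreteMeasurableSpace (Event n) := ⟨fun _ => trivial⟩

/-- The count is the counting measure of a section of a measurable set. An infinite section gives 0
under both `Set.ncard` and `toReal`, so the two agree everywhere. -/
theorem measurable_ringCount (t : ℝ) :
    Measurable fun τ : ℕ → ℝ => ringCount (n := n) (τ, fun _ => Event.flip 0) t := by
  let s : Set ((ℕ → ℝ) × ℕ) := {p | ∑ i ∈ Finset.range (p.2 + 1), p.1 i ≤ t}
  have hs : MeasurableSet s := by
    refine measurableSet_le ?_ measurable_const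
    exact measurable_from_prod_countable_left fun k => by dsimp; fun_prop
  have h := (measurable_measure_prodMk_left (ν := Measure.count) hs).ennreal_toReal
  have h2 := Nat.measurable_floor.comp h
  convert h2 using 2 with τ
  simp only [Function.comp_apply, ringCount]
  rw [Measure.count_apply (measurable_prodMk_left hs)]
  rw [Set.ncard]
  change _ = ⌊(ENat.toENNReal (Set.encard {k : ℕ | ∑ i ∈ Finset.range (k + 1), τ i ≤ t})).toReal⌋₊
  generalize Set.encard {k : ℕ | ∑ i ∈ Finset.range (k + 1), τ i ≤ t} = N
  cases N using ENat.recTopCoe <;> simp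

theorem tendsto_ringCount_atTop {ω : ClockSpace n}
    (h : Tendsto (fun k => ∑ i ∈ Finset.range k, ω.1 i) atTop atTop) :
    Tendsto (ringCount ω) atTop atTop := by
  refine tendsto_atTop.2 fun m => ?_
  have hev : ∀ᶠ t : ℝ in atTop, ∀ k ∈ Finset.range m,
      ∑ i ∈ Finset.range (k + 1), ω.1 i ≤ t :=
    (Finset.eventually_all _).2 fun k _ => eventually_ge_atTop _
  filter_upwards [hev] with t ht
  -- Finiteness matters: `Set.ncard` would be 0 on an infinite set.
  have hfin : {k : ℕ | ∑ i ∈ Finset.range (k + 1), ω.1 i ≤ t}.Finite := by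
    obtain ⟨K, hK⟩ :=
      ((h.comp (tendsto_add_atTop_nat 1)).eventually_gt_atTop t).exists_forall_of_atTop
    refine (Finset.range K).finite_toSet.subset fun k hk => ?_
    by_contra hk'
    simp only [Finset.coe_range, Set.mem_Iio, not_lt] at hk'
    exact absurd hk (not_le.2 (hK k hk'))
  calc m = (Finset.range m : Set ℕ).ncard := by rw [Set.ncard_coe_finset, Finset.card_range]
    _ ≤ _ := Set.ncard_le_ncard (fun k hk => ht k hk) hfin

/-! ### The embedded chain and its expectations -/

/-- State after `k` rings of the given types. -/
def chain (z₀ : NetState n) (x : ℕ → Event n) (k : ℕ) : NetState n :=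
  stateAfter z₀ (0, x) k

theorem stateAfter_eq_chain (z₀ : NetState n) (ω : ClockSpace n) (k : ℕ) :
    stateAfter z₀ ω k = chain z₀ ω.2 k := by
  induction k with
  | zero => rfl
  | succ k ih => exact congrArg (step (ω.2 k)) ih

theorem chain_succ (z₀ : NetState n) (x : ℕ → Event n) (k : ℕ) :
    chain z₀ x (k + 1) = step (x k) (chain z₀ x k) := rfl

theorem dependsOn_chain (z₀ : NetState n) (k : ℕ) :
    DependsOn (fun x => chain z₀ x k) (Finset.range k : Set ℕ) := by
  induction k with
  | zero => exact fun _ _ _ => rfl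
  | succ k ih =>
    intro x y h
    simp only [chain_succ]
    rw [h k (by simp)]
    exact congrArg _ (ih fun i hi => h i (by simp at hi ⊢; omega))

/-- Factoring through finitely many marks, a finite space, yields measurability and integrability of
every function of the state, with no σ-algebra on `NetState`. -/
theorem exists_chain_eq (z₀ : NetState n) (k : ℕ) :
    ∃ g : (Finset.range k → Event n) → NetState n,
      ∀ x, chain z₀ x k = g fun i => x i := by
  have : Nonempty (NetState n) := ⟨z₀⟩
  obtain ⟨g, hg⟩ := dependsOn_iff_exists_comp.1 (dependsOn_chain z₀ k)
  exact ⟨g, fun x => congrFun hg x⟩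

theorem measurable_comp_chain {β : Type*} [MeasurableSpace β] (f : NetState n → β)
    (z₀ : NetState n) (k : ℕ) : Measurable fun x => f (chain z₀ x k) := by
  obtain ⟨g, hg⟩ := exists_chain_eq z₀ k
  simp only [hg]
  exact (Measurable.of_discrete (f := fun y => f (g y))).comp (by fun_prop)

theorem integrable_comp_chain (P : Measure (ℕ → Event n)) [IsFiniteMeasure P]
    (ψ : NetState n → ℝ) (z₀ : NetState n) (k : ℕ) :
    Integrable (fun x => ψ (chain z₀ x k)) P := by
  obtain ⟨g, hg⟩ := exists_chain_eq z₀ k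
  simp only [hg]
  have hm : Measurable fun (x : ℕ → Event n) (i : Finset.range k) => x i := by fun_prop
  exact (Integrable.of_finite (f := fun y => ψ (g y))).comp_measurable hm

theorem isProbabilityMeasure_markMeasure {r : Rates} (hr : ∀ e, 0 ≤ r.rate n e)
    (ht : 0 < r.total n) : IsProbabilityMeasure (markMeasure r n) := by
  refine ⟨?_⟩
  simp only [markMeasure, Measure.coe_finsetSum, Finset.sum_apply, Measure.smul_apply,
    measure_univ, smul_eq_mul, mul_one]
  rw [← ENNReal.ofReal_sum_of_nonneg fun e _ => div_nonneg (hr e) ht.le, ← Finset.sum_div]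
  change ENNReal.ofReal (r.total n / r.total n) = 1
  rw [div_self ht.ne', ENNReal.ofReal_one]

theorem markMeasure_real_singleton {r : Rates} (hr : ∀ e, 0 ≤ r.rate n e)
    (ht : 0 < r.total n) (e : Event n) :
    (markMeasure r n).real {e} = r.rate n e / r.total n := by
  classical
  rw [measureReal_def, markMeasure]
  simp only [Measure.coe_finsetSum, Finset.sum_apply, Measure.smul_apply,
    Measure.dirac_apply, smul_eq_mul, Set.indicator_apply, Set.mem_singleton_iff, Pi.one_apply,
    mul_ite, mul_one, mul_zero, Finset.sum_ite_eq', Finset.mem_univ, if_true]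
  exact ENNReal.toReal_ofReal (div_nonneg (hr e) ht.le)

/-- Expectation of a function of the state after `k` rings. -/
noncomputable def chainExpect (r : Rates) (z₀ : NetState n) (ψ : NetState n → ℝ) (k : ℕ) : ℝ :=
  ∫ x, ψ (chain z₀ x k) ∂(Measure.infinitePi fun _ : ℕ => markMeasure r n)

/-- The mark numbered `k` is independent of the earlier marks, which determine the state after `k`
rings. -/
theorem chainExpect_succ {r : Rates} (hr : ∀ e, 0 ≤ r.rate n e)
    (ht : 0 < r.total n) (z₀ : NetState n) (ψ : NetState n → ℝ) (k : ℕ) :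
    chainExpect r z₀ ψ (k + 1) =
      ∑ e, r.rate n e / r.total n * chainExpect r z₀ (fun z => ψ (step e z)) k := by
  classical
  have := isProbabilityMeasure_markMeasure hr ht
  set P := Measure.infinitePi fun _ : ℕ => markMeasure r n with hP
  let one (e : Event n) (y : Event n) : ℝ := if y = e then 1 else 0
  have hsplit : ∀ x, ψ (chain z₀ x (k + 1)) =
      ∑ e, one e (x k) * ψ (step e (chain z₀ x k)) := fun x => by
    simp [chain_succ, one]
  have hind : iIndepFun (fun (i : ℕ) (x : ℕ → Event n) => x i) P :=
    iIndepFun_infinitePi (X := fun _ => id) fun _ => measurable_id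
  have hdis : Disjoint {k} (Finset.range k) := by simp
  have hpair := hind.indepFun_finset {k} (Finset.range k) hdis fun i => measurable_pi_apply i
  have hone : ∀ e, ∫ x, one e (x k) ∂P = r.rate n e / r.total n := fun e => by
    have hev := measurePreserving_eval_infinitePi (fun _ : ℕ => markMeasure r n) k
    rw [← integral_map (φ := fun x : ℕ → Event n => x k) hev.measurable.aemeasurable
      Measurable.of_discrete.aestronglyMeasurable, hev.map_eq,
      ← markMeasure_real_singleton hr ht, ← integral_indicator_one (MeasurableSet.of_discrete)]
    congr 1
  have hmul : ∀ e, ∫ x, one e (x k) * ψ (step e (chain z₀ x k)) ∂P =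
      r.rate n e / r.total n * ∫ x, ψ (step e (chain z₀ x k)) ∂P := fun e => by
    obtain ⟨g, hg⟩ := exists_chain_eq z₀ k
    rw [← hone e]
    simp only [hg]
    exact hpair.integral_fun_comp_mul_comp
      (f := fun y => one e (y ⟨k, by simp⟩)) (g := fun y => ψ (step e (g y)))
      (measurable_pi_lambda _ fun i => measurable_pi_apply _).aemeasurable
      (measurable_pi_lambda _ fun i => measurable_pi_apply _).aemeasurable
      Measurable.of_discrete.aestronglyMeasurable Measurable.of_discrete.aestronglyMeasurable
  rw [chainExpect, ← hP]
  simp only [hsplit]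
  rw [integral_finsetSum _ fun e _ => ?_]
  · exact Finset.sum_congr rfl fun e _ => hmul e
  · have h := integrable_comp_chain P (fun z => ψ (step e z)) z₀ k
    refine h.bdd_mul (c := 1) ?_ (Eventually.of_forall fun x => ?_)
    · exact ((Measurable.of_discrete (f := one e)).comp
        (measurable_pi_apply k)).aestronglyMeasurable
    · simp only [one]
      split_ifs <;> simp

/-! ### Passage to continuous time -/

/-- A limit along the embedded chain is a limit in continuous time. -/
theorem tendsto_expect {r : Rates} (hr : ∀ e, 0 ≤ r.rate n e)
    (ht : 0 < r.total n) (z₀ : NetState n) {ψ : NetState n → ℝ} {C a : ℝ}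
    (hψ : ∀ z, |ψ z| ≤ C) (ha : Tendsto (chainExpect r z₀ ψ) atTop (𝓝 a)) :
    Tendsto (expect r z₀ ψ) atTop (𝓝 a) := by
  have := isProbabilityMeasure_markMeasure hr ht
  have := isProbabilityMeasure_expMeasure ht
  set P := Measure.infinitePi fun _ : ℕ => markMeasure r n with hP
  set D := Measure.infinitePi fun _ : ℕ => expMeasure (r.total n) with hD
  -- The count ignores the marks, so constant dummy marks exhibit it as a function of the waiting
  -- times alone.
  let N (t : ℝ) (τ : ℕ → ℝ) : ℕ := ringCount (n := n) (τ, fun _ => Event.flip 0) t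
  have hN : ∀ t, Measurable (N t) := measurable_ringCount
  have hmeas : ∀ t, Measurable fun ω : ClockSpace n => ψ (chain z₀ ω.2 (N t ω.1)) := fun t => by
    have h1 : Measurable fun p : (ℕ → Event n) × ℕ => ψ (chain z₀ p.1 p.2) :=
      measurable_from_prod_countable_left fun k => measurable_comp_chain ψ z₀ k
    exact h1.comp (measurable_snd.prodMk ((hN t).comp measurable_fst))
  have hexp : ∀ t, expect r z₀ ψ t = ∫ τ, chainExpect r z₀ ψ (N t τ) ∂D := fun t => by
    rw [expect, clockMeasure]
    simp only [stateAt, stateAfter_eq_chain]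
    exact integral_prod _ (Integrable.of_bound (hmeas t).aestronglyMeasurable C
      (Eventually.of_forall fun ω => hψ _))
  have hbound : ∀ k, ‖chainExpect r z₀ ψ k‖ ≤ C := fun k => by
    refine (norm_integral_le_of_norm_le_const (C := C)
      (Eventually.of_forall fun x => hψ _)).trans ?_
    simp
  have hlim : Tendsto (fun t => ∫ τ, chainExpect r z₀ ψ (N t τ) ∂D) atTop (𝓝 (∫ _, a ∂D)) := by
    refine tendsto_integral_filter_of_dominated_convergence (fun _ => C) ?_ ?_
      (integrable_const C) ?_
    · exact Eventually.of_forall fun t =>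
        ((Measurable.of_discrete (f := chainExpect r z₀ ψ)).comp (hN t)).aestronglyMeasurable
    · exact Eventually.of_forall fun t => Eventually.of_forall fun τ => hbound _
    · filter_upwards [ae_tendsto_sum_infinitePi_atTop (ae_pos_expMeasure ht)] with τ hτ
      exact ha.comp (tendsto_ringCount_atTop (ω := (τ, fun _ => Event.flip 0)) hτ)
  rw [funext hexp]
  simpa using hlim

theorem chainExpect_mem_Icc {r : Rates} (hr : ∀ e, 0 ≤ r.rate n e) (ht : 0 < r.total n)
    (z₀ : NetState n) {ψ : NetState n → ℝ} (hψ : ∀ z, ψ z ∈ Set.Icc (0 : ℝ) 1) (k : ℕ) :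
    chainExpect r z₀ ψ k ∈ Set.Icc (0 : ℝ) 1 := by
  have := isProbabilityMeasure_markMeasure hr ht
  refine ⟨integral_nonneg fun x => (hψ _).1, ?_⟩
  refine (integral_mono (integrable_comp_chain _ ψ z₀ k) (integrable_const 1)
    fun x => (hψ _).2).trans ?_
  simp

theorem chainExpect_add {r : Rates} (hr : ∀ e, 0 ≤ r.rate n e) (ht : 0 < r.total n)
    (z₀ : NetState n) (φ ψ : NetState n → ℝ) (k : ℕ) :
    chainExpect r z₀ (fun z => φ z + ψ z) k =
      chainExpect r z₀ φ k + chainExpect r z₀ ψ k := by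
  have := isProbabilityMeasure_markMeasure hr ht
  exact integral_add (integrable_comp_chain _ φ z₀ k) (integrable_comp_chain _ ψ z₀ k)

theorem chainExpect_sub {r : Rates} (hr : ∀ e, 0 ≤ r.rate n e) (ht : 0 < r.total n)
    (z₀ : NetState n) (φ ψ : NetState n → ℝ) (k : ℕ) :
    chainExpect r z₀ (fun z => φ z - ψ z) k =
      chainExpect r z₀ φ k - chainExpect r z₀ ψ k := by
  have := isProbabilityMeasure_markMeasure hr ht
  exact integral_sub (integrable_comp_chain _ φ z₀ k) (integrable_comp_chain _ ψ z₀ k)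

theorem chainExpect_const_mul (r : Rates)
    (z₀ : NetState n) (c : ℝ) (ψ : NetState n → ℝ) (k : ℕ) :
    chainExpect r z₀ (fun z => c * ψ z) k = c * chainExpect r z₀ ψ k :=
  integral_const_mul _ _

theorem chainExpect_sum {r : Rates} (hr : ∀ e, 0 ≤ r.rate n e) (ht : 0 < r.total n)
    (z₀ : NetState n) {ι : Type*} (s : Finset ι) (ψ : ι → NetState n → ℝ) (k : ℕ) :
    chainExpect r z₀ (fun z => ∑ i ∈ s, ψ i z) k = ∑ i ∈ s, chainExpect r z₀ (ψ i) k := by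
  have := isProbabilityMeasure_markMeasure hr ht
  exact integral_finsetSum _ fun i _ => integrable_comp_chain _ (ψ i) z₀ k

/-! ### The generator and contracting affine recursions -/

/-- Action of the generator of the network on a function of the state. -/
noncomputable def drift (r : Rates) (ψ : NetState n → ℝ) (z : NetState n) : ℝ :=
  ∑ e, r.rate n e * (ψ (step e z) - ψ z)

theorem chainExpect_succ_eq_add_drift {r : Rates} (hr : ∀ e, 0 ≤ r.rate n e)
    (ht : 0 < r.total n) (z₀ : NetState n) (ψ : NetState n → ℝ) (k : ℕ) :
    chainExpect r z₀ ψ (k + 1) =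
      chainExpect r z₀ ψ k + (r.total n)⁻¹ * chainExpect r z₀ (drift r ψ) k := by
  rw [chainExpect_succ hr ht, ← chainExpect_const_mul, ← chainExpect_add hr ht]
  simp_rw [← chainExpect_const_mul]
  rw [← chainExpect_sum hr ht]
  congr 1
  funext z
  have h : ∑ e, r.rate n e * ψ z = r.total n * ψ z := (Finset.sum_mul _ _ _).symm
  simp only [drift, mul_sub, Finset.sum_sub_distrib, h]
  rw [inv_mul_cancel_left₀ ht.ne', add_sub_cancel, Finset.mul_sum]
  exact Finset.sum_congr rfl fun e _ => by ring

theorem tendsto_zero_of_le_mul_add {s ε : ℕ → ℝ} {ρ : ℝ} (hs : ∀ k, 0 ≤ s k) (h0 : 0 ≤ ρ)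
    (h1 : ρ < 1) (hε : Tendsto ε atTop (𝓝 0)) (h : ∀ k, s (k + 1) ≤ ρ * s k + ε k) :
    Tendsto s atTop (𝓝 0) := by
  refine Metric.tendsto_atTop.2 fun δ hδ => ?_
  obtain ⟨K, hK⟩ := (hε.eventually_lt_const
    (show 0 < (1 - ρ) * (δ / 2) by have := sub_pos.2 h1; positivity)).exists_forall_of_atTop
  -- Past `K` the forcing is below `(1 - ρ) * (δ / 2)`, for which `δ / 2` is the fixed point of the
  -- recursion.
  have hj : ∀ j, s (K + j) ≤ ρ ^ j * s K + δ / 2 := fun j => by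
    induction j with
    | zero => simp; positivity
    | succ j ih =>
      calc s (K + j + 1) ≤ ρ * s (K + j) + ε (K + j) := h _
        _ ≤ ρ * (ρ ^ j * s K + δ / 2) + (1 - ρ) * (δ / 2) :=
          add_le_add (mul_le_mul_of_nonneg_left ih h0) (hK _ (Nat.le_add_right _ _)).le
        _ = ρ ^ (j + 1) * s K + δ / 2 := by ring
  have hp : Tendsto (fun j => ρ ^ j * s K) atTop (𝓝 0) := by
    simpa using (tendsto_pow_atTop_nhds_zero_of_lt_one h0 h1).mul_const (s K)
  obtain ⟨J, hJ⟩ := (hp.eventually_lt_const (half_pos hδ)).exists_forall_of_atTop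
  refine ⟨K + J, fun k hk => ?_⟩
  obtain ⟨j, rfl⟩ := Nat.exists_eq_add_of_le (show K ≤ k by omega)
  rw [Real.dist_eq, sub_zero, abs_of_nonneg (hs _)]
  have := hJ j (by omega)
  have := hj j
  linarith

/-- Convergence of a planar affine recursion with convergent forcing. -/
theorem tendsto_planar_recursion {w g : ℕ → Fin 2 → ℝ} {q W G : Fin 2 → ℝ} {β L : ℝ}
    (hq : ∀ m, 0 ≤ q m) (hβ : 0 < β) (hL : q 0 + q 1 + β ≤ L)
    (hw : ∀ k m, w (k + 1) m =
      w k m + L⁻¹ * (g k m - (q m + β) * w k m - q (1 - m) * w k (1 - m)))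
    (hW : ∀ m, (q m + β) * W m + q (1 - m) * W (1 - m) = G m)
    (hg : ∀ m, Tendsto (fun k => g k m) atTop (𝓝 (G m))) (m : Fin 2) :
    Tendsto (fun k => w k m) atTop (𝓝 (W m)) := by
  have hq0 := hq 0
  have hq1 := hq 1
  have hL0 : 0 < L := by linarith
  have hε : Tendsto (fun k => L⁻¹ * (|g k 0 - G 0| + |g k 1 - G 1|)) atTop (𝓝 0) := by
    have h (m) : Tendsto (fun k => |g k m - G m|) atTop (𝓝 0) := by
      simpa using ((hg m).sub_const (G m)).abs
    simpa using ((h 0).add (h 1)).const_mul L⁻¹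
  have key : Tendsto (fun k => |w k 0 - W 0| + |w k 1 - W 1|) atTop (𝓝 0) := by
    -- In the summed error, coordinate `m` has weight `L - (q m + β)` from itself and `q m` from the
    -- other equation: `L - β` in total, divided by `L`.
    refine tendsto_zero_of_le_mul_add (ρ := 1 - β / L) (fun k => by positivity)
      (sub_nonneg.2 ((div_le_one hL0).2 (by linarith))) (sub_lt_self _ (by positivity)) hε
      fun k => ?_
    have hsm (m) (hm : q m + β ≤ L) : |w (k + 1) m - W m| ≤
        L⁻¹ * ((L - (q m + β)) * |w k m - W m| + q (1 - m) * |w k (1 - m) - W (1 - m)|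
          + |g k m - G m|) := by
      have : w (k + 1) m - W m = L⁻¹ * ((L - (q m + β)) * (w k m - W m)
          - q (1 - m) * (w k (1 - m) - W (1 - m)) + (g k m - G m)) := by
        rw [hw, ← hW m]
        field_simp
        ring
      rw [this, abs_mul, abs_of_pos (inv_pos.2 hL0)]
      refine mul_le_mul_of_nonneg_left ?_ (inv_pos.2 hL0).le
      refine (abs_add_le _ _).trans (add_le_add_left ((abs_sub _ _).trans ?_) _)
      rw [abs_mul, abs_mul, abs_of_nonneg (hq (1 - m)), abs_of_nonneg (by linarith)]
    have e0 := hsm 0 (by linarith)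
    have e1 := hsm 1 (by linarith)
    simp only [sub_zero, sub_self] at e0 e1
    refine (add_le_add e0 e1).trans (le_of_eq ?_)
    field_simp
    ring
  have hle : ∀ k, |w k m - W m| ≤ |w k 0 - W 0| + |w k 1 - W 1| := fun k => by
    fin_cases m
    · exact le_add_of_nonneg_right (abs_nonneg _)
    · exact le_add_of_nonneg_left (abs_nonneg _)
  exact tendsto_iff_norm_sub_tendsto_zero.2
    (squeeze_zero (fun k => norm_nonneg _) hle key)

theorem exists_planar_solution {q : Fin 2 → ℝ} {β : ℝ} (hq : ∀ m, 0 ≤ q m) (hβ : 0 < β)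
    (G : Fin 2 → ℝ) :
    ∃ W : Fin 2 → ℝ, ∀ m, (q m + β) * W m + q (1 - m) * W (1 - m) = G m := by
  have hq0 := hq 0
  have hq1 := hq 1
  have hd : β * (q 0 + q 1 + β) ≠ 0 := by positivity
  -- Cramer's rule; the denominator is the determinant `(q 0 + β) * (q 1 + β) - q 0 * q 1`.
  refine ⟨fun m => ((q (1 - m) + β) * G m - q (1 - m) * G (1 - m)) / (β * (q 0 + q 1 + β)),
    fun m => ?_⟩
  rw [mul_div_assoc', mul_div_assoc', ← add_div, div_eq_iff hd]
  fin_cases m <;> simp <;> ring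

/-! ### Consistency and the freshest node under each transition -/

theorem NetState.Consistent.step {z : NetState n} (hz : z.Consistent) (e : Event n) :
    (step e z).Consistent := by
  obtain ⟨h1, h2⟩ := hz
  cases e with
  | flip m =>
    simp only [GossipAccuracy.step]
    split_ifs
    · exact ⟨fun i j h => h1 i j (by simpa using h), fun i h => by simp at h⟩
    · exact ⟨h1, h2⟩
  | push j =>
    refine ⟨fun a b h => ?_, fun a h => ?_⟩
    · simp only [GossipAccuracy.step, Function.update_apply] at h ⊢
      split_ifs at h ⊢
      · rfl
      · exact (h2 b h.symm).symm
      · exact h2 a h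
      · exact h1 a b h
    · simp only [GossipAccuracy.step, Function.update_apply] at h ⊢
      split_ifs at h ⊢
      · rfl
      · exact h2 a h
  | gossip p =>
    simp only [GossipAccuracy.step]
    split_ifs
    · refine ⟨fun a b h => ?_, fun a h => ?_⟩
      · simp only [Function.update_apply] at h ⊢
        split_ifs at h ⊢
        · rfl
        · exact h1 _ _ h
        · exact h1 _ _ h
        · exact h1 _ _ h
      · simp only [Function.update_apply] at h ⊢
        split_ifs at h ⊢
        · exact h2 _ h
        · exact h2 _ h
    · exact ⟨h1, h2⟩

theorem NetState.Consistent.chain {z₀ : NetState n} (hz : z₀.Consistent) (x : ℕ → Event n)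
    (k : ℕ) : (chain z₀ x k).Consistent := by
  induction k with
  | zero => exact hz
  | succ k ih => exact ih.step (x k)

theorem chainExpect_congr {z₀ : NetState n} (hz : z₀.Consistent) (r : Rates)
    {φ ψ : NetState n → ℝ} (h : ∀ z : NetState n, z.Consistent → φ z = ψ z) (k : ℕ) :
    chainExpect r z₀ φ k = chainExpect r z₀ ψ k := by
  simp only [chainExpect, h _ (hz.chain _ k)]

theorem exists_freshest (z : NetState n) {A : Finset (Fin n)} (hA : A.Nonempty) :
    ∃ l ∈ A, ∀ x ∈ A, z.age l ≤ z.age x :=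
  A.exists_min_image z.age hA

/-- Consistency makes ties harmless, so any convenient minimizer may be used. -/
theorem freshAccuracy_eq {z : NetState n} (hz : z.Consistent) {A : Finset (Fin n)} {l : Fin n}
    (hl : l ∈ A) (hmin : ∀ x ∈ A, z.age l ≤ z.age x) :
    freshAccuracy A z = if z.content l = z.source then 1 else 0 := by
  unfold freshAccuracy
  congr 1
  refine propext ⟨?_, fun h => ⟨l, hl, hmin, h⟩⟩
  rintro ⟨j, hj, hjmin, h⟩
  rw [hz.1 l j (le_antisymm (hmin j hj) (hjmin l hl)), h]

theorem freshAccuracy_singleton (z : NetState n) (l : Fin n) :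
    freshAccuracy {l} z = nodeAccuracy z l := by
  simp [freshAccuracy, nodeAccuracy]

theorem freshAccuracy_mem_Icc (A : Finset (Fin n)) (z : NetState n) :
    freshAccuracy A z ∈ Set.Icc (0 : ℝ) 1 := by
  unfold freshAccuracy
  split_ifs <;> simp

theorem modeIndicator_mem_Icc (m : Fin 2) (z : NetState n) :
    modeIndicator m z ∈ Set.Icc (0 : ℝ) 1 := by
  unfold modeIndicator
  split_ifs <;> simp

/-- All ages shift equally, so the freshest node persists; with only two source states, right and
wrong are exchanged. -/
theorem freshAccuracy_flip {z : NetState n} (hz : z.Consistent) {A : Finset (Fin n)}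
    (hA : A.Nonempty) {m : Fin 2} (hm : z.source = m) :
    freshAccuracy A (step (.flip m) z) = 1 - freshAccuracy A z := by
  obtain ⟨l, hl, hmin⟩ := exists_freshest z hA
  have hs := hz.step (.flip m)
  rw [freshAccuracy_eq hz hl hmin, freshAccuracy_eq (l := l) hs hl]
  · simp only [step, hm, if_true]
    generalize z.content l = c
    fin_cases c <;> fin_cases m <;> simp
  · intro x hx
    simpa [step, if_pos hm] using hmin x hx

theorem freshAccuracy_push_of_mem {z : NetState n} (hz : z.Consistent) {A : Finset (Fin n)}
    {j : Fin n} (hj : j ∈ A) : freshAccuracy A (step (.push j) z) = 1 := by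
  rw [freshAccuracy_eq (hz.step _) hj]
  · simp [step]
  · simp [step]

theorem freshAccuracy_push_of_notMem {z : NetState n} (hz : z.Consistent) {A : Finset (Fin n)}
    (hA : A.Nonempty) {j : Fin n} (hj : j ∉ A) :
    freshAccuracy A (step (.push j) z) = freshAccuracy A z := by
  obtain ⟨l, hl, hmin⟩ := exists_freshest z hA
  have hne : ∀ x ∈ A, x ≠ j := fun x hx h => hj (h ▸ hx)
  rw [freshAccuracy_eq hz hl hmin, freshAccuracy_eq (l := l) (hz.step _) hl]
  · simp [step, hne l hl]
  · intro x hx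
    simpa [step, hne l hl, hne x hx] using hmin x hx

theorem freshAccuracy_gossip_of_notMem {z : NetState n} (hz : z.Consistent)
    {A : Finset (Fin n)} (hA : A.Nonempty) {p : {p : Fin n × Fin n // p.1 ≠ p.2}}
    (hp : p.1.2 ∉ A) : freshAccuracy A (step (.gossip p) z) = freshAccuracy A z := by
  by_cases h : z.age p.1.1 < z.age p.1.2
  · obtain ⟨l, hl, hmin⟩ := exists_freshest z hA
    have hne : ∀ x ∈ A, x ≠ p.1.2 := fun x hx h => hp (h ▸ hx)
    rw [freshAccuracy_eq hz hl hmin, freshAccuracy_eq (l := l) (hz.step _) hl]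
    · simp [step, h, hne l hl]
    · intro x hx
      simpa [step, h, hne l hl, hne x hx] using hmin x hx
  · simp [step, h]

/-- After the transmission `A` holds the freshest packet of `insert p.1.1 A`, whether or not it was
accepted. This is what couples sets of successive sizes. -/
theorem freshAccuracy_gossip_of_mem {z : NetState n} (hz : z.Consistent)
    {A : Finset (Fin n)} {p : {p : Fin n × Fin n // p.1 ≠ p.2}} (hp : p.1.2 ∈ A) :
    freshAccuracy A (step (.gossip p) z) = freshAccuracy (insert p.1.1 A) z := by
  obtain ⟨⟨i, j⟩, hij⟩ := p
  simp only at hp hij ⊢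
  by_cases h : z.age i < z.age j
  · obtain ⟨l, hl, hmin⟩ := exists_freshest z (Finset.insert_nonempty i A)
    have hs := hz.step (.gossip ⟨(i, j), hij⟩)
    have hage : ∀ x, (step (.gossip ⟨(i, j), hij⟩) z).age x =
        if x = j then z.age i else z.age x := fun x => by
      simp [step, h, Function.update_apply]
    have hcon : ∀ x, (step (.gossip ⟨(i, j), hij⟩) z).content x =
        if x = j then z.content i else z.content x := fun x => by
      simp [step, h, Function.update_apply]
    have hsrc : (step (.gossip ⟨(i, j), hij⟩) z).source = z.source := by
      simp [step, h]
    have hli : z.age l ≤ z.age i := hmin i (Finset.mem_insert_self i A)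
    rw [freshAccuracy_eq hz hl hmin]
    have hbound : ∀ x ∈ A, z.age l ≤ (step (.gossip ⟨(i, j), hij⟩) z).age x := fun x hx => by
      rw [hage]
      split_ifs
      · exact hli
      · exact hmin x (Finset.mem_insert_of_mem hx)
    -- If the minimum is attained by the sender, `j` now holds that packet; otherwise the minimizer
    -- lies in `A`, differs from `j`, and is untouched.
    by_cases hlieq : z.age l = z.age i
    · rw [freshAccuracy_eq (l := j) hs hp]
      · rw [hcon, hsrc, if_pos rfl, hz.1 l i hlieq]
      · intro x hx
        rw [hage j, if_pos rfl, ← hlieq]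
        exact hbound x hx
    · have hlj : l ≠ j := by rintro rfl; omega
      have hlA : l ∈ A := (Finset.mem_insert.1 hl).resolve_left (by rintro rfl; exact hlieq rfl)
      rw [freshAccuracy_eq (l := l) hs hlA]
      · rw [hcon, hsrc, if_neg hlj]
      · intro x hx
        rw [hage l, if_neg hlj]
        exact hbound x hx
  · obtain ⟨l, hl, hmin⟩ := exists_freshest z ⟨j, hp⟩
    rw [show step (.gossip ⟨(i, j), hij⟩) z = z by simp [step, h], freshAccuracy_eq hz hl hmin,
      freshAccuracy_eq (l := l) hz (Finset.mem_insert_of_mem hl)]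
    intro x hx
    rcases Finset.mem_insert.1 hx with rfl | hx
    · exact (hmin j hp).trans (not_lt.1 h)
    · exact hmin x hx

theorem source_gossip (z : NetState n) (p : {p : Fin n × Fin n // p.1 ≠ p.2}) :
    (step (.gossip p) z).source = z.source := by
  simp only [step]
  split_ifs <;> rfl

/-! ### Drifts of the mode and of the freshest-node accuracy -/

theorem sum_event (f : Event n → ℝ) :
    ∑ e, f e = ∑ m, f (.flip m) + (∑ j, f (.push j) + ∑ p, f (.gossip p)) := by
  rw [← (eventEquiv n).sum_comp, Fintype.sum_sum_type, Fintype.sum_sum_type]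
  rfl

/-- The rate at which the source leaves each state. -/
def Rates.leave (r : Rates) (m : Fin 2) : ℝ := if m = 0 then r.q12 else r.q21

theorem drift_modeIndicator (r : Rates) (m : Fin 2) (z : NetState n) :
    drift r (modeIndicator m) z =
      r.leave (1 - m) * modeIndicator (1 - m) z - r.leave m * modeIndicator m z := by
  have hp (j : Fin n) : modeIndicator m (step (.push j) z) = modeIndicator m z := rfl
  have hg (p) : modeIndicator m (step (.gossip p) z) = modeIndicator m z := by
    simp only [modeIndicator, source_gossip]
  rw [drift, sum_event]
  simp only [hp, hg, sub_self, mul_zero, Finset.sum_const_zero, add_zero]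
  obtain ⟨s, c, a⟩ := z
  fin_cases m <;> fin_cases s <;>
    simp [Fin.sum_univ_two, modeIndicator, step, Rates.rate, Rates.leave]

theorem sum_gossip (f : Fin n → Fin n → ℝ) (hf : ∀ i, f i i = 0) :
    ∑ p : {p : Fin n × Fin n // p.1 ≠ p.2}, f p.1.1 p.1.2 = ∑ j, ∑ i, f i j := by
  rw [Finset.sum_comm, ← Fintype.sum_prod_type' f,
    ← Finset.sum_subtype (Finset.univ.filter fun p : Fin n × Fin n => p.1 ≠ p.2) (by simp)
      fun p => f p.1 p.2]
  exact Finset.sum_filter_of_ne fun p _ hp h => hp (by rw [h, hf])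

/-- Total rate of the pushes and gossips that can refresh a set of `a` nodes. -/
noncomputable def Rates.refresh (r : Rates) (n a : ℕ) : ℝ :=
  a * (r.lamS / n) + a * (r.lam / ((n : ℝ) - 1)) * ((n : ℝ) - a)

theorem drift_freshAccuracy (r : Rates) (m : Fin 2) {A : Finset (Fin n)} (hA : A.Nonempty)
    {z : NetState n} (hz : z.Consistent) :
    drift r (fun z => freshAccuracy A z * modeIndicator m z) z =
      (r.leave (1 - m) * modeIndicator (1 - m) z + A.card * (r.lamS / n) * modeIndicator m z
        + A.card * (r.lam / ((n : ℝ) - 1)) *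
          ∑ i ∈ Aᶜ, freshAccuracy (insert i A) z * modeIndicator m z)
      - (r.leave m + r.refresh n A.card) * (freshAccuracy A z * modeIndicator m z)
      - r.leave (1 - m) * (freshAccuracy A z * modeIndicator (1 - m) z) := by
  classical
  have hflip : ∑ s, r.rate n (.flip s) *
      (freshAccuracy A (step (.flip s) z) * modeIndicator m (step (.flip s) z)
        - freshAccuracy A z * modeIndicator m z) =
      r.leave (1 - m) * (modeIndicator (1 - m) z - freshAccuracy A z * modeIndicator (1 - m) z)
        - r.leave m * (freshAccuracy A z * modeIndicator m z) := by
    have hf := freshAccuracy_flip hz hA (m := z.source) rfl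
    have hne (s : Fin 2) (hs : z.source ≠ s) : step (.flip s) z = z := by simp [step, hs]
    rw [Fin.sum_univ_two]
    by_cases h0 : z.source = 0
    · rw [hne 1 (by simp [h0])]
      rw [h0] at hf
      rw [hf]
      fin_cases m <;> simp [modeIndicator, step, h0, Rates.rate, Rates.leave]
    · have h1 : z.source = 1 := by omega
      rw [hne 0 h0]
      rw [h1] at hf
      rw [hf]
      fin_cases m <;> simp [modeIndicator, step, h1, Rates.rate, Rates.leave]
  have hpush : ∑ j, r.rate n (.push j) *
      (freshAccuracy A (step (.push j) z) * modeIndicator m (step (.push j) z)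
        - freshAccuracy A z * modeIndicator m z) =
      A.card * (r.lamS / n) * (modeIndicator m z - freshAccuracy A z * modeIndicator m z) := by
    rw [← Finset.sum_subset (Finset.subset_univ A), Finset.sum_congr rfl fun j hj => ?_,
      Finset.sum_const, nsmul_eq_mul, mul_assoc]
    · rw [freshAccuracy_push_of_mem hz hj, one_mul]
      rfl
    · intro j _ hj
      rw [freshAccuracy_push_of_notMem hz hA hj]
      exact mul_eq_zero_of_right _ (sub_self _)
  have hgossip : ∑ p, r.rate n (.gossip p) *
      (freshAccuracy A (step (.gossip p) z) * modeIndicator m (step (.gossip p) z)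
        - freshAccuracy A z * modeIndicator m z) =
      A.card * (r.lam / ((n : ℝ) - 1)) *
        (∑ i ∈ Aᶜ, freshAccuracy (insert i A) z * modeIndicator m z
          - ((n : ℝ) - A.card) * (freshAccuracy A z * modeIndicator m z)) := by
    let f : Fin n → Fin n → ℝ := fun i j => if j ∈ A then r.lam / ((n : ℝ) - 1) *
      (freshAccuracy (insert i A) z * modeIndicator m z
        - freshAccuracy A z * modeIndicator m z) else 0
    have hterm (p : {p : Fin n × Fin n // p.1 ≠ p.2}) : r.rate n (.gossip p) *
        (freshAccuracy A (step (.gossip p) z) * modeIndicator m (step (.gossip p) z)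
          - freshAccuracy A z * modeIndicator m z) = f p.1.1 p.1.2 := by
      simp only [f, modeIndicator, source_gossip]
      by_cases hp : p.1.2 ∈ A
      · rw [freshAccuracy_gossip_of_mem hz hp, if_pos hp]
        rfl
      · rw [freshAccuracy_gossip_of_notMem hz hA hp, if_neg hp, sub_self, mul_zero]
    have hins (i) (hi : i ∈ A) : insert i A = A := Finset.insert_eq_of_mem hi
    have hcard : ((Aᶜ.card : ℕ) : ℝ) = (n : ℝ) - A.card := by
      rw [Finset.card_compl, Fintype.card_fin, Nat.cast_sub (by simpa using A.card_le_univ)]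
    simp only [hterm]
    -- The diagonal can be added for free, and senders inside `A` drop out, because `insert i A = A`
    -- for them.
    rw [sum_gossip f fun i => by simp +contextual [f, hins],
      ← Finset.sum_subset (Finset.subset_univ A) fun j _ hj => by simp [f, hj],
      Finset.sum_congr rfl fun j hj => ?_, Finset.sum_const, nsmul_eq_mul, mul_assoc]
    rw [← Finset.sum_subset (Finset.subset_univ Aᶜ) fun i _ hi => by
      simp [f, hins i (by simpa using hi)]]
    simp only [f, if_pos hj]
    rw [← Finset.mul_sum, Finset.sum_sub_distrib, Finset.sum_const, nsmul_eq_mul, hcard]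
  rw [drift, sum_event, hflip, hpush, hgossip, Rates.refresh]
  ring

/-! ### Rate bounds and convergence of the source -/

theorem Rates.total_eq (r : Rates) (hn : 2 ≤ n) :
    r.total n = r.q12 + r.q21 + r.lamS + n * r.lam := by
  have h1 : (n : ℝ) - 1 ≠ 0 := by
    have : (2 : ℝ) ≤ n := by exact_mod_cast hn
    linarith
  have h0 : (n : ℝ) ≠ 0 := by positivity
  have hg := sum_gossip (fun i j : Fin n => if i = j then 0 else r.lam / ((n : ℝ) - 1))
    (by simp)
  rw [Finset.sum_congr rfl fun p _ => if_neg p.2] at hg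
  have hin (j : Fin n) : ∑ i : Fin n, (if i = j then 0 else r.lam / ((n : ℝ) - 1)) = r.lam := by
    have : ∀ i : Fin n, (if i = j then 0 else r.lam / ((n : ℝ) - 1)) =
        r.lam / ((n : ℝ) - 1) - if i = j then r.lam / ((n : ℝ) - 1) else 0 := fun i => by
      split_ifs <;> simp
    simp only [this, Finset.sum_sub_distrib, Finset.sum_ite_eq', Finset.mem_univ, if_true,
      Finset.sum_const, Finset.card_univ, Fintype.card_fin, nsmul_eq_mul]
    field_simp
  simp only [hin] at hg
  rw [Rates.total, sum_event]
  simp only [Rates.rate]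
  rw [hg]
  simp [Fin.sum_univ_two]
  field_simp
  ring

/-- The standing assumptions on the rates. -/
structure Rates.Admissible (r : Rates) : Prop where
  q12_pos : 0 < r.q12
  q21_pos : 0 < r.q21
  lamS_pos : 0 < r.lamS
  lam_nonneg : 0 ≤ r.lam

theorem Rates.Admissible.rate_nonneg {r : Rates} (h : r.Admissible) (hn : 2 ≤ n)
    (e : Event n) : 0 ≤ r.rate n e := by
  obtain ⟨h12, h21, hS, hlam⟩ := h
  have : (2 : ℝ) ≤ n := by exact_mod_cast hn
  cases e with
  | flip m =>
    simp only [Rates.rate]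
    split_ifs <;> positivity
  | push j => exact div_nonneg hS.le (by linarith)
  | gossip p => exact div_nonneg hlam (by linarith)

theorem Rates.Admissible.total_pos {r : Rates} (h : r.Admissible) (hn : 2 ≤ n) :
    0 < r.total n := by
  obtain ⟨h12, h21, hS, hlam⟩ := h
  rw [r.total_eq hn]
  positivity

theorem Rates.Admissible.leave_pos {r : Rates} (h : r.Admissible) (m : Fin 2) :
    0 < r.leave m := by
  unfold Rates.leave
  split_ifs
  exacts [h.q12_pos, h.q21_pos]

theorem stationary_eq (r : Rates) (m : Fin 2) :
    stationary r.q12 r.q21 m = r.leave (1 - m) / (r.leave m + r.leave (1 - m)) := by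
  fin_cases m <;> simp [stationary, Rates.leave, add_comm]

theorem modeIndicator_one_sub (m : Fin 2) (z : NetState n) :
    modeIndicator (1 - m) z = 1 - modeIndicator m z := by
  obtain ⟨s, c, a⟩ := z
  fin_cases m <;> fin_cases s <;> simp [modeIndicator]

/-- The two mode probabilities sum to 1, so the distance of one of them to its stationary value
shrinks by a constant factor at each ring. -/
theorem Rates.Admissible.tendsto_modeIndicator {r : Rates} (h : r.Admissible) (hn : 2 ≤ n)
    (z₀ : NetState n) (m : Fin 2) :
    Tendsto (chainExpect r z₀ (modeIndicator m)) atTop (𝓝 (stationary r.q12 r.q21 m)) := by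
  have hr := h.rate_nonneg hn
  have ht := h.total_pos hn
  have hL : r.leave m + r.leave (1 - m) ≤ r.total n := by
    have hS := h.lamS_pos.le
    have hlam := h.lam_nonneg
    have : r.leave m + r.leave (1 - m) = r.q12 + r.q21 := by
      fin_cases m <;> simp [Rates.leave, add_comm]
    rw [this, r.total_eq hn]
    have : 0 ≤ n * r.lam := by positivity
    linarith
  have h1 := h.leave_pos m
  have h2 := h.leave_pos (1 - m)
  have hdrift : drift r (modeIndicator (n := n) m) = fun z => r.leave (1 - m)
      + -(r.leave m + r.leave (1 - m)) * modeIndicator m z := by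
    funext z
    rw [drift_modeIndicator, modeIndicator_one_sub]
    ring
  have := isProbabilityMeasure_markMeasure hr ht
  have hconst (c : ℝ) (k : ℕ) : chainExpect r z₀ (fun _ => c) k = c := by simp [chainExpect]
  have hrec (k) : chainExpect r z₀ (modeIndicator m) (k + 1) - stationary r.q12 r.q21 m =
      (1 - (r.leave m + r.leave (1 - m)) / r.total n) *
        (chainExpect r z₀ (modeIndicator m) k - stationary r.q12 r.q21 m) := by
    rw [chainExpect_succ_eq_add_drift hr ht, hdrift, chainExpect_add hr ht,
      chainExpect_const_mul, hconst, stationary_eq]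
    field_simp
    ring
  have h0 : 0 ≤ 1 - (r.leave m + r.leave (1 - m)) / r.total n :=
    sub_nonneg.2 ((div_le_one ht).2 hL)
  refine tendsto_iff_norm_sub_tendsto_zero.2 (tendsto_zero_of_le_mul_add
    (fun k => norm_nonneg _) h0 (sub_lt_self _ (by positivity)) tendsto_const_nhds fun k => ?_)
  rw [hrec, norm_mul, Real.norm_of_nonneg h0, add_zero]

/-! ### Descending induction on the size of the set -/

/-- The equation satisfied by the limiting accuracies `f` of the freshest node of a set of `a`
nodes, given those of the sets with one more node. -/
def Rates.IsFreshLimit (r : Rates) (n a : ℕ) (f f' : Fin 2 → ℝ) : Prop :=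
  ∀ m, (r.leave m + r.refresh n a) * f m + r.leave (1 - m) * f (1 - m) =
    r.leave (1 - m) * stationary r.q12 r.q21 (1 - m)
      + a * (r.lamS / n) * stationary r.q12 r.q21 m
      + a * (r.lam / ((n : ℝ) - 1)) * (((n : ℝ) - a) * f' m)

/-- `f` collects the limits of the accuracies of the freshest nodes of the sets of `a` nodes along
the embedded chain. -/
def Rates.HasFreshLimit (r : Rates) (n a : ℕ) (f : Fin 2 → ℝ) : Prop :=
  ∀ z₀ : NetState n, z₀.Consistent → ∀ A : Finset (Fin n), A.card = a → ∀ m,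
    Tendsto (chainExpect r z₀ fun z => freshAccuracy A z * modeIndicator m z) atTop (𝓝 (f m))

theorem Rates.Admissible.refresh_pos {r : Rates} (h : r.Admissible) (hn : 2 ≤ n) {a : ℕ}
    (ha : 1 ≤ a) (han : a ≤ n) : 0 < r.refresh n a := by
  have hS := h.lamS_pos
  have hlam := h.lam_nonneg
  have h2 : (2 : ℝ) ≤ n := by exact_mod_cast hn
  have h3 : (a : ℝ) ≤ n := by exact_mod_cast han
  have h4 : (0 : ℝ) < a := by exact_mod_cast ha
  have := div_nonneg hlam (show (0 : ℝ) ≤ n - 1 by linarith)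
  have := sub_nonneg.2 h3
  unfold Rates.refresh
  positivity

/-- This keeps the coefficients of the discrete recursion nonnegative, as the contraction requires.
-/
theorem Rates.Admissible.leave_add_refresh_le {r : Rates} (h : r.Admissible) (hn : 2 ≤ n)
    {a : ℕ} (ha : 1 ≤ a) (han : a ≤ n) :
    r.leave 0 + r.leave 1 + r.refresh n a ≤ r.total n := by
  have hS := h.lamS_pos
  have hlam := h.lam_nonneg
  have h2 : (2 : ℝ) ≤ n := by exact_mod_cast hn
  have h3 : (a : ℝ) ≤ n := by exact_mod_cast han
  have h4 : (1 : ℝ) ≤ a := by exact_mod_cast ha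
  have h5 : (a : ℝ) * (r.lamS / n) ≤ r.lamS := by
    rw [mul_div_assoc', div_le_iff₀ (by linarith), mul_comm]
    exact mul_le_mul_of_nonneg_left h3 hS.le
  have h6 : r.lam / ((n : ℝ) - 1) * ((n : ℝ) - a) ≤ r.lam := by
    rw [div_mul_eq_mul_div, div_le_iff₀ (by linarith)]
    exact mul_le_mul_of_nonneg_left (by linarith) hlam
  have h7 : (a : ℝ) * (r.lam / ((n : ℝ) - 1)) * ((n : ℝ) - a) ≤ n * r.lam := by
    rw [mul_assoc]
    exact (mul_le_mul_of_nonneg_left h6 (by linarith)).trans (mul_le_mul_of_nonneg_right h3 hlam)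
  rw [r.total_eq hn, Rates.refresh]
  simp only [Rates.leave, if_true, one_ne_zero, if_false]
  linarith

/-- The `n - a` outside nodes all contribute the same limit `f'`, so the limiting equation sees only
the size. For `a = n` there are none, and nothing is asked of `f'`. -/
theorem Rates.Admissible.hasFreshLimit_of_succ {r : Rates} (h : r.Admissible) (hn : 2 ≤ n)
    {a : ℕ} (ha : 1 ≤ a) (han : a ≤ n) {f f' : Fin 2 → ℝ} (hf : r.IsFreshLimit n a f f')
    (hf' : a < n → r.HasFreshLimit n (a + 1) f') : r.HasFreshLimit n a f := by
  intro z₀ hz A hA m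
  have hr := h.rate_nonneg hn
  have ht := h.total_pos hn
  have hne : A.Nonempty := Finset.card_pos.1 (by omega)
  let w (k : ℕ) (m : Fin 2) : ℝ :=
    chainExpect r z₀ (fun z => freshAccuracy A z * modeIndicator m z) k
  let g (k : ℕ) (m : Fin 2) : ℝ := r.leave (1 - m) * chainExpect r z₀ (modeIndicator (1 - m)) k
    + a * (r.lamS / n) * chainExpect r z₀ (modeIndicator m) k
    + a * (r.lam / ((n : ℝ) - 1)) * ∑ i ∈ Aᶜ,
      chainExpect r z₀ (fun z => freshAccuracy (insert i A) z * modeIndicator m z) k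
  refine tendsto_planar_recursion (w := w) (g := g) (fun m => (h.leave_pos m).le)
    (h.refresh_pos hn ha han) (h.leave_add_refresh_le hn ha han) (fun k m => ?_) hf
    (fun m => ?_) m
  · simp only [w, g]
    rw [chainExpect_succ_eq_add_drift hr ht]
    congr 2
    simp only [← chainExpect_const_mul, ← chainExpect_sum hr ht, ← chainExpect_add hr ht,
      ← chainExpect_sub hr ht]
    refine chainExpect_congr hz r (fun z hz => ?_) k
    rw [drift_freshAccuracy r m hne hz, hA]
  · refine (((h.tendsto_modeIndicator hn z₀ (1 - m)).const_mul _).add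
      ((h.tendsto_modeIndicator hn z₀ m).const_mul _)).add (Tendsto.const_mul _ ?_)
    have hsum : ((n : ℝ) - a) * f' m = ∑ i ∈ Aᶜ, f' m := by
      rw [Finset.sum_const, nsmul_eq_mul, Finset.card_compl, Fintype.card_fin, hA,
        Nat.cast_sub han]
    rw [hsum]
    refine tendsto_finsetSum _ fun i hi => ?_
    have hi' : i ∉ A := by simpa using hi
    have hcard : (insert i A).card = a + 1 := by rw [Finset.card_insert_of_notMem hi', hA]
    refine hf' ?_ z₀ hz _ hcard m
    have := (insert i A).card_le_univ
    rw [hcard, Fintype.card_fin] at this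
    omega

theorem Rates.Admissible.exists_isFreshLimit {r : Rates} (h : r.Admissible) (hn : 2 ≤ n)
    {a : ℕ} (ha : 1 ≤ a) (han : a ≤ n) (f' : Fin 2 → ℝ) : ∃ f, r.IsFreshLimit n a f f' :=
  exists_planar_solution (fun m => (h.leave_pos m).le) (h.refresh_pos hn ha han) _

theorem Rates.Admissible.exists_hasFreshLimit {r : Rates} (h : r.Admissible) (hn : 2 ≤ n)
    {a : ℕ} (ha : 1 ≤ a) (han : a ≤ n) : ∃ f, r.HasFreshLimit n a f := by
  induction han using Nat.decreasingInduction with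
  | self =>
    -- The value 0 is arbitrary: its coefficient `n - a` vanishes.
    obtain ⟨f, hf⟩ := h.exists_isFreshLimit hn ha le_rfl 0
    exact ⟨f, h.hasFreshLimit_of_succ hn ha le_rfl hf fun h => absurd h (lt_irrefl _)⟩
  | of_succ a han ih =>
    obtain ⟨f', hf'⟩ := ih (by omega)
    obtain ⟨f, hf⟩ := h.exists_isFreshLimit hn ha han.le f'
    exact ⟨f, h.hasFreshLimit_of_succ hn ha han.le hf fun _ => hf'⟩

theorem abs_freshAccuracy_mul_modeIndicator_le (A : Finset (Fin n)) (m : Fin 2)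
    (z : NetState n) : |freshAccuracy A z * modeIndicator m z| ≤ 1 := by
  have h1 := freshAccuracy_mem_Icc A z
  have h2 := modeIndicator_mem_Icc m z
  rw [abs_of_nonneg (mul_nonneg h1.1 h2.1)]
  exact mul_le_one₀ h1.2 h2.1 h2.2

theorem Rates.HasFreshLimit.mem_Icc {r : Rates} (h : r.Admissible) (hn : 2 ≤ n) {a : ℕ}
    (han : a ≤ n) {f : Fin 2 → ℝ} (hf : r.HasFreshLimit n a f) (m : Fin 2) :
    f m ∈ Set.Icc (0 : ℝ) 1 := by
  obtain ⟨A, -, hA⟩ := Finset.exists_subset_card_eq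
    (s := (Finset.univ : Finset (Fin n))) (n := a) (by simpa using han)
  refine isClosed_Icc.mem_of_tendsto (hf ⟨0, fun _ => 0, fun _ => 0⟩
    ⟨fun _ _ _ => rfl, fun _ _ => rfl⟩ A hA m) (Eventually.of_forall fun k => ?_)
  refine chainExpect_mem_Icc (h.rate_nonneg hn) (h.total_pos hn) _ (fun z => ?_) k
  have h1 := freshAccuracy_mem_Icc A z
  have h2 := modeIndicator_mem_Icc m z
  exact ⟨mul_nonneg h1.1 h2.1, mul_le_one₀ h1.2 h2.1 h2.2⟩

/-! ### Average accuracies and the linear system -/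

theorem avgAccuracy_mul_modeIndicator (A : Finset (Fin n)) (m : Fin 2) (z : NetState n) :
    avgAccuracy A z * modeIndicator m z =
      (A.card : ℝ)⁻¹ * ∑ l ∈ A, freshAccuracy {l} z * modeIndicator m z := by
  simp only [avgAccuracy, freshAccuracy_singleton, ← Finset.sum_mul]
  ring

theorem avgAccuracy_eq_sum_modeIndicator (A : Finset (Fin n)) (z : NetState n) :
    avgAccuracy A z =
      avgAccuracy A z * modeIndicator 0 z + avgAccuracy A z * modeIndicator 1 z := by
  have := modeIndicator_one_sub 0 z
  rw [sub_zero] at this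
  rw [this]
  ring

theorem abs_avgAccuracy_le (A : Finset (Fin n)) (z : NetState n) : |avgAccuracy A z| ≤ 1 := by
  have h0 (l) : 0 ≤ nodeAccuracy z l ∧ nodeAccuracy z l ≤ 1 := by
    unfold nodeAccuracy
    split_ifs <;> simp
  rw [avgAccuracy, abs_of_nonneg
    (div_nonneg (Finset.sum_nonneg fun l _ => (h0 l).1) (Nat.cast_nonneg _))]
  refine div_le_one_of_le₀ ?_ (Nat.cast_nonneg _)
  simpa using Finset.sum_le_sum fun l (_ : l ∈ A) => (h0 l).2

theorem Rates.HasFreshLimit.tendsto_avgAccuracy {r : Rates} (h : r.Admissible) (hn : 2 ≤ n)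
    {c : Fin 2 → ℝ} (hc : r.HasFreshLimit n 1 c) {z₀ : NetState n} (hz : z₀.Consistent)
    {A : Finset (Fin n)} (hA : A.Nonempty) (m : Fin 2) :
    Tendsto (chainExpect r z₀ fun z => avgAccuracy A z * modeIndicator m z) atTop
      (𝓝 (c m)) := by
  have hA0 : (A.card : ℝ) ≠ 0 := by exact_mod_cast hA.card_ne_zero
  have hlim := (tendsto_finsetSum A fun l _ => hc z₀ hz {l} (Finset.card_singleton l) m).const_mul
    (A.card : ℝ)⁻¹
  rw [Finset.sum_const, nsmul_eq_mul, inv_mul_cancel_left₀ hA0] at hlim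
  refine hlim.congr fun k => ?_
  simp only [avgAccuracy_mul_modeIndicator]
  rw [chainExpect_const_mul, chainExpect_sum (h.rate_nonneg hn) (h.total_pos hn)]

/-- Existence of the limits, with the equation that links those of single nodes and pairs. -/
theorem Rates.Admissible.exists_limits {r : Rates} (h : r.Admissible) (hn : 2 ≤ n) :
    ∃ f₂ c : Fin 2 → ℝ, r.HasFreshLimit n 2 f₂ ∧ r.HasFreshLimit n 1 c ∧
      ∀ m, (r.leave m + r.lamS / n + r.lam) * c m + r.leave (1 - m) * c (1 - m) =
        r.leave (1 - m) * stationary r.q12 r.q21 (1 - m)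
          + r.lamS / n * stationary r.q12 r.q21 m + r.lam * f₂ m := by
  obtain ⟨f₂, hf₂⟩ := h.exists_hasFreshLimit hn one_le_two hn
  obtain ⟨c, hc⟩ := h.exists_isFreshLimit hn le_rfl (by omega : 1 ≤ n) f₂
  refine ⟨f₂, c, hf₂, h.hasFreshLimit_of_succ hn le_rfl (by omega) hc fun _ => hf₂,
    fun m => ?_⟩
  have hn1 : (n : ℝ) - 1 ≠ 0 := by
    have : (2 : ℝ) ≤ n := by exact_mod_cast hn
    linarith
  have hm := hc m
  have hl : (1 : ℝ) * (r.lam / ((n : ℝ) - 1)) * ((n : ℝ) - 1) = r.lam := by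
    field_simp
  simp only [Rates.refresh, Nat.cast_one, ← mul_assoc, hl] at hm
  linarith

theorem Rates.Admissible.systemMatrix_mulVec_eq_iff {r : Rates} (h : r.Admissible)
    (hn : 2 ≤ n) {f₂ c : Fin 2 → ℝ}
    (hc : ∀ m, (r.leave m + r.lamS / n + r.lam) * c m + r.leave (1 - m) * c (1 - m) =
        r.leave (1 - m) * stationary r.q12 r.q21 (1 - m)
          + r.lamS / n * stationary r.q12 r.q21 m + r.lam * f₂ m) (x : Fin 2 → ℝ) :
    r.systemMatrix n *ᵥ x = r.systemVector n + r.lam • f₂ ↔ x = c := by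
  obtain ⟨h12, h21, hS, hlam⟩ := h
  have h0 := hc 0
  have h1 := hc 1
  simp only [Rates.leave, sub_zero, sub_self, if_true, one_ne_zero, if_false] at h0 h1
  have hmat : r.systemMatrix n *ᵥ x = r.systemVector n + r.lam • f₂ ↔
      (r.q12 + r.lamS / n + r.lam) * x 0 + r.q21 * x 1 =
        r.q21 * stationary r.q12 r.q21 1 + r.lamS / n * stationary r.q12 r.q21 0
          + r.lam * f₂ 0 ∧
      r.q12 * x 0 + (r.q21 + r.lamS / n + r.lam) * x 1 =
        r.q12 * stationary r.q12 r.q21 0 + r.lamS / n * stationary r.q12 r.q21 1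
          + r.lam * f₂ 1 := by
    rw [funext_iff, Fin.forall_fin_two]
    simp [Rates.systemMatrix, Rates.systemVector, Matrix.mulVec, dotProduct, Fin.sum_univ_two]
  rw [hmat, ← h0, ← h1]
  constructor
  · rintro ⟨e0, e1⟩
    have hβ : 0 < r.lamS / n + r.lam := by
      have : (0 : ℝ) < n := by positivity
      positivity
    generalize r.lamS / n = μ at *
    -- The determinant of the system matrix.
    have hdet : (μ + r.lam) * (r.q12 + r.q21 + (μ + r.lam)) ≠ 0 := by positivity
    rw [funext_iff, Fin.forall_fin_two]
    constructor
    · refine mul_left_cancel₀ hdet ?_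
      linear_combination (r.q21 + μ + r.lam) * e0 - r.q21 * e1
    · refine mul_left_cancel₀ hdet ?_
      linear_combination (r.q12 + μ + r.lam) * e1 - r.q12 * e0
  · rintro rfl
    exact ⟨rfl, by ring⟩

/-! ### Large push rate -/

theorem stationary_mem_Icc {q12 q21 : ℝ} (h12 : 0 < q12) (h21 : 0 < q21) (m : Fin 2) :
    stationary q12 q21 m ∈ Set.Icc (0 : ℝ) 1 := by
  fin_cases m
  · exact ⟨by simp [stationary]; positivity, div_le_one_of_le₀ (by linarith) (by positivity)⟩
  · exact ⟨by simp [stationary]; positivity, div_le_one_of_le₀ (by linarith) (by positivity)⟩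

/-- Isolating the push terms leaves differences of numbers in [0, 1] weighted by `q12`, `q21` and
`lam`. -/
theorem Rates.Admissible.abs_limit_sub_stationary_le {r : Rates} (h : r.Admissible)
    (hn : 2 ≤ n) {f₂ c : Fin 2 → ℝ} (hf₂ : ∀ m, f₂ m ∈ Set.Icc (0 : ℝ) 1)
    (hc01 : ∀ m, c m ∈ Set.Icc (0 : ℝ) 1)
    (hc : ∀ m, (r.leave m + r.lamS / n + r.lam) * c m + r.leave (1 - m) * c (1 - m) =
        r.leave (1 - m) * stationary r.q12 r.q21 (1 - m)
          + r.lamS / n * stationary r.q12 r.q21 m + r.lam * f₂ m) (m : Fin 2) :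
    |c m - stationary r.q12 r.q21 m| ≤ n * (r.q12 + r.q21 + r.lam) / r.lamS := by
  have hπ := stationary_mem_Icc h.q12_pos h.q21_pos
  have hq := h.leave_pos m
  have hq' := h.leave_pos (1 - m)
  have hlam := h.lam_nonneg
  have hS := h.lamS_pos
  have hn0 : (0 : ℝ) < n := by positivity
  have hsum : r.q12 + r.q21 = r.leave m + r.leave (1 - m) := by
    fin_cases m <;> simp [Rates.leave, add_comm]
  have heq : r.lamS / n * (c m - stationary r.q12 r.q21 m) =
      r.leave (1 - m) * (stationary r.q12 r.q21 (1 - m) - c (1 - m)) + r.lam * (f₂ m - c m)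
        - r.leave m * c m := by
    linear_combination hc m
  have hb : |r.lamS / n * (c m - stationary r.q12 r.q21 m)| ≤ r.q12 + r.q21 + r.lam := by
    obtain ⟨a1, a2⟩ := hπ (1 - m)
    obtain ⟨b1, b2⟩ := hc01 (1 - m)
    obtain ⟨c1, c2⟩ := hc01 m
    obtain ⟨d1, d2⟩ := hf₂ m
    rw [heq, hsum, abs_le]
    have e1 := mul_le_mul_of_nonneg_left (show stationary r.q12 r.q21 (1 - m) - c (1 - m) ≤ 1 by
      linarith) hq'.le
    have e2 := mul_le_mul_of_nonneg_left (show -1 ≤ stationary r.q12 r.q21 (1 - m) - c (1 - m) by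
      linarith) hq'.le
    have e3 := mul_le_mul_of_nonneg_left (show f₂ m - c m ≤ 1 by linarith) hlam
    have e4 := mul_le_mul_of_nonneg_left (show -1 ≤ f₂ m - c m by linarith) hlam
    have e5 := mul_le_mul_of_nonneg_left c1 hq.le
    have e6 := mul_le_mul_of_nonneg_left c2 hq.le
    constructor <;> linarith
  rw [abs_mul, abs_of_pos (by positivity), div_mul_eq_mul_div, div_le_iff₀ hn0] at hb
  rw [le_div_iff₀ hS]
  linarith

end GossipAccuracy

theorem mainTheorem5 (n : ℕ) (hn : 2 ≤ n) (q12 q21 lam : ℝ)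
    (h12 : 0 < q12) (h21 : 0 < q21) (hlam : 0 ≤ lam) :
    ∃ f₂ c : ℝ → Fin 2 → ℝ,
      (∀ lamS : ℝ, 0 < lamS →
        (∀ z₀ : NetState n, z₀.Consistent → ∀ A : Finset (Fin n), A.card = 2 → ∀ m : Fin 2,
          Tendsto (expect ⟨q12, q21, lamS, lam⟩ z₀
              (fun z => freshAccuracy A z * modeIndicator m z))
            atTop (𝓝 (f₂ lamS m))) ∧
        (∀ z₀ : NetState n, z₀.Consistent → ∀ A : Finset (Fin n), A.Nonempty →
          (∀ m : Fin 2,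
            Tendsto (expect ⟨q12, q21, lamS, lam⟩ z₀
                (fun z => avgAccuracy A z * modeIndicator m z))
              atTop (𝓝 (c lamS m))) ∧
          Tendsto (expect ⟨q12, q21, lamS, lam⟩ z₀ (avgAccuracy A))
            atTop (𝓝 (c lamS 0 + c lamS 1))) ∧
        (∀ x : Fin 2 → ℝ,
          (Rates.mk q12 q21 lamS lam).systemMatrix n *ᵥ x =
              (Rates.mk q12 q21 lamS lam).systemVector n + lam • f₂ lamS ↔
            x = c lamS)) ∧
      (∀ m : Fin 2, Tendsto (fun lamS : ℝ => c lamS m) atTop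
        (𝓝 (stationary q12 q21 m))) ∧
      Tendsto (fun lamS : ℝ => c lamS 0 + c lamS 1) atTop (𝓝 1) := by
  let R (lamS : ℝ) : Rates := ⟨q12, q21, lamS, lam⟩
  have hR (lamS : ℝ) (hS : 0 < lamS) : (R lamS).Admissible := ⟨h12, h21, hS, hlam⟩
  have hex (lamS : ℝ) : ∃ f₂ c : Fin 2 → ℝ, 0 < lamS →
      (R lamS).HasFreshLimit n 2 f₂ ∧ (R lamS).HasFreshLimit n 1 c ∧
      ∀ m, ((R lamS).leave m + lamS / n + lam) * c m + (R lamS).leave (1 - m) * c (1 - m) =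
        (R lamS).leave (1 - m) * stationary q12 q21 (1 - m)
          + lamS / n * stationary q12 q21 m + lam * f₂ m := by
    by_cases hS : 0 < lamS
    · obtain ⟨f₂, c, h⟩ := (hR lamS hS).exists_limits hn
      exact ⟨f₂, c, fun _ => h⟩
    -- Junk values at nonpositive push rates, so that the limits become functions on all of ℝ.
    · exact ⟨0, 0, fun h => absurd h hS⟩
  choose f₂ c hfc using hex
  have hlim (m : Fin 2) :
      Tendsto (fun lamS : ℝ => c lamS m) atTop (𝓝 (stationary q12 q21 m)) := by
    refine tendsto_iff_norm_sub_tendsto_zero.2 (squeeze_zero' (Eventually.of_forall fun _ =>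
      norm_nonneg _) ?_ (tendsto_const_nhds.div_atTop (a := n * (q12 + q21 + lam)) tendsto_id))
    filter_upwards [eventually_gt_atTop 0] with lamS hS
    obtain ⟨hf, hc, heq⟩ := hfc lamS hS
    exact (hR lamS hS).abs_limit_sub_stationary_le hn (hf.mem_Icc (hR lamS hS) hn hn)
      (hc.mem_Icc (hR lamS hS) hn (by omega)) heq m
  refine ⟨f₂, c, fun lamS hS => ?_, hlim, ?_⟩
  · have h := hR lamS hS
    have hr := h.rate_nonneg hn
    have ht := h.total_pos hn
    obtain ⟨hf, hc, heq⟩ := hfc lamS hS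
    refine ⟨fun z₀ hz A hA m => tendsto_expect hr ht z₀
      (abs_freshAccuracy_mul_modeIndicator_le A m) (hf z₀ hz A hA m),
      fun z₀ hz A hA => ⟨fun m => ?_, ?_⟩, h.systemMatrix_mulVec_eq_iff hn heq⟩
    · refine tendsto_expect hr ht z₀ (C := 1) (fun z => ?_) (hc.tendsto_avgAccuracy h hn hz hA m)
      have h2 := modeIndicator_mem_Icc m z
      rw [abs_mul, abs_of_nonneg h2.1]
      exact mul_le_one₀ (abs_avgAccuracy_le A z) h2.1 h2.2
    · refine tendsto_expect hr ht z₀ (abs_avgAccuracy_le A) ?_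
      refine ((hc.tendsto_avgAccuracy h hn hz hA 0).add
        (hc.tendsto_avgAccuracy h hn hz hA 1)).congr fun k => ?_
      rw [← chainExpect_add hr ht]
      simp only [← avgAccuracy_eq_sum_modeIndicator]
  · have hs : stationary q12 q21 0 + stationary q12 q21 1 = 1 := by
      simp only [stationary, Matrix.cons_val_zero, Matrix.cons_val_one]
      field_simp
      ring
    exact hs ▸ (hlim 0).add (hlim 1)
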